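/- Let $X, X_1, X_2, \dots$ be i.i.d. real random variables with $\mathbb{E}X = 0$ and $\mathrm{Var}(X) = 1$, let $f(t) = \mathbb{E}\,e^{itX}$ be their common characteristic function, put $Z_n = (X_1 + \dots + X_n)/\sqrt{n}$ for $n \ge 1$, and let $Z$ be a standard Gaussian random variable. For a real random variable $Y$ with density $p$ and $1 < r < \infty$, define the Rényi entropy and the Rényi entropy power by $$h_r(Y) = -\frac{1}{r-1} \log \int_{-\infty}^{\infty} p(x)^r\,dx \in [-\infty, \infty), \qquad N_r(Y) = e^{2h_r(Y)} = \Big(\int_{-\infty}^{\infty} p(x)^r\,dx\Big)^{-\frac{2}{r-1}} \in [0, \infty),$$ and let $h_\infty(Y) = -\log \|p\|_\infty$ and $N_\infty(Y) = \|p\|_\infty^{-2}$, where $\|p\|_\infty$ is the essential supremum of $p$. Thus $h_r(Y) = -\infty$ and $N_r(Y) = 0$ if the integral, respectively the essential supremum, is infinite; the same values are assigned if the distribution of $Y$ has no density. Then for every $1 < r \le \infty$ the following five conditions are equivalent: 1. $N_r(Z_n) \to N_r(Z)$ as $n \to \infty$; 2. $h_r(Z_n) \to h_r(Z)$ as $n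 \to \infty$; 3. $\int_{-\infty}^{\infty} |f(t)|^\nu\,dt < \infty$ for some real $\nu \ge 1$; 4. $Z_n$ has a bounded density for all sufficiently large $n$; 5. $Z_n$ has a bounded density for some $n \ge 1$. -/

import Mathlib

open MeasureTheory ProbabilityTheory Filter Topology
open scoped ENNReal NNReal

/-- The Rényi entropy `h_r(X)` of index `1 < r ≤ ∞` of a real random variable `X`, as an extended
real number. If `X` has a density `p`, it is `-(1/(r-1)) log ∫ p(x)^r dx` for `r < ∞`, and
`-log ‖p‖_∞` (essential supremum) for `r = ∞`; the value is `-∞` if the integral, respectively the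
essential supremum, is infinite. If the law of `X` has no density, the value is `-∞`. -/
noncomputable def renyiEntropy {Ω : Type*} [MeasurableSpace Ω] (r : ℝ≥0∞) (X : Ω → ℝ)
    (P : Measure Ω) : EReal :=
  open scoped Classical in
  if HasPDF X P volume then
    if r = ∞ then - ENNReal.log (essSup (pdf X P volume) volume)
    else ((-(1 / (r.toReal - 1)) : ℝ) : EReal) *
      ENNReal.log (∫⁻ x, (pdf X P volume x) ^ r.toReal)
  else ⊥

/-- The Rényi entropy power `N_r(X)` of index `1 < r ≤ ∞` of a real random variable `X`. If `X` has
a density `p`, it is `(∫ p(x)^r dx)^(-2/(r-1))` for `r < ∞`, and `‖p‖_∞^(-2)` for `r = ∞`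
(with `∞` to a negative power equal to `0`). If the law of `X` has no density, the value is `0`. -/
noncomputable def renyiEntropyPower {Ω : Type*} [MeasurableSpace Ω] (r : ℝ≥0∞) (X : Ω → ℝ)
    (P : Measure Ω) : ℝ≥0∞ :=
  open scoped Classical in
  if HasPDF X P volume then
    if r = ∞ then (essSup (pdf X P volume) volume) ^ (-2 : ℝ)
    else (∫⁻ x, (pdf X P volume x) ^ r.toReal) ^ (-(2 / (r.toReal - 1)))
  else 0

/-- `X` has a bounded density with respect to Lebesgue measure. A density is determined up to null
sets, so this means that its Radon-Nikodym derivative is bounded almost everywhere. -/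
def HasBoundedDensity {Ω : Type*} [MeasurableSpace Ω] (X : Ω → ℝ) (P : Measure Ω) : Prop :=
  HasPDF X P volume ∧ ∃ M : ℝ≥0, ∀ᵐ x, pdf X P volume x ≤ M

/-- The normalized sum `Z_n = (X_1 + ... + X_n) / √n`; the sequence is indexed from `0`, so the
first `n` terms are `X 0, ..., X (n - 1)`. -/
noncomputable def normalizedSum {Ω : Type*} (X : ℕ → Ω → ℝ) (n : ℕ) : Ω → ℝ :=
  fun ω => (∑ k ∈ Finset.range n, X k ω) / √(n : ℝ)

/-! Everything passes through condition 3, using that `Z_n` has characteristic function `f(t/√n)^n`.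

To reach 3: the Gaussian limit is nonzero, so under 1 some `Z_n` has a density `p` in `L^r` (bounded
if `r = ∞`, hence in `L²`). Cut `p` at a height `T`. The low part has a bounded density, so
Plancherel bounds the `L²` norm of its transform; the high part has mass at most `T^(1-r) ∫ p^r`,
which bounds its transform uniformly. Choosing `T` in terms of the level `l` gives `|{|φ| > l}| ≤ K
l^(-s)` for the characteristic function `φ` of `Z_n` (`volume_lt_norm_charFun_le`), and the
layer-cake formula makes a high power of `φ` integrable. Condition 5 is handled the same way with
exponent 2.

From 3: an integer power of `|f|` is integrable, so `|f|` vanishes at infinity and stays below some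
`η < 1` away from 0. Gaussian domination near 0 and the geometric factor `η^n` elsewhere give
`f(t/√n)^n → e^(-t²/2)` in `L¹` (`tendsto_integral_norm_charFun_pow_sub`). Fourier inversion then
yields bounded densities and their uniform convergence; since all have mass 1, their `L^r` norms
converge (`tendsto_eLpNorm_inversionDensity`). `N_r` is a continuous function of the `L^r` norm, and
`h_r` is the logarithm of `√N_r`. -/

/-! ### Gaussian regularization and a Plancherel bound -/

section Parseval

/-- Parseval's formula for the characteristic functions of two finite measures. -/
lemma integral_charFun_comm (μ ν : Measure ℝ) [IsFiniteMeasure μ] [IsFiniteMeasure ν] :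
    ∫ t, charFun μ t ∂ν = ∫ x, charFun ν x ∂μ := by
  simp only [charFun_apply_real]
  rw [integral_integral_swap]
  · simp only [mul_comm]
  · refine Integrable.of_bound (by fun_prop) 1 (ae_of_all _ fun z => le_of_eq ?_)
    simp only [Function.uncurry]
    rw [← Complex.ofReal_mul, Complex.norm_exp_ofReal_mul_I]

/-- Parseval against the Gaussian law of variance `v`, whose characteristic function is again
Gaussian. As `v → ∞` the damping factor on the left tends to 1. -/
lemma integral_charFun_mul_gaussian (μ : Measure ℝ) [IsFiniteMeasure μ] {v : ℝ≥0} (hv : v ≠ 0) :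
    ∫ t : ℝ, charFun μ t * (Real.exp (-t ^ 2 / (2 * v)) : ℂ) =
      ((√(2 * Real.pi * v) * ∫ x, Real.exp (-(v * x ^ 2) / 2) ∂μ : ℝ) : ℂ) := by
  have h := integral_charFun_comm μ (gaussianReal 0 v)
  rw [integral_gaussianReal_eq_integral_smul hv] at h
  have hs : √(2 * Real.pi * v) ≠ 0 := by
    have : (0 : ℝ) < v := by positivity
    positivity
  have h1 : ∀ t : ℝ, charFun μ t * (Real.exp (-t ^ 2 / (2 * v)) : ℂ) =
      (√(2 * Real.pi * v) : ℂ) * (gaussianPDFReal 0 v t • charFun μ t) := by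
    intro t
    rw [gaussianPDFReal_def, Complex.real_smul]
    push_cast
    have : (√(2 * Real.pi * v) : ℂ) ≠ 0 := by exact_mod_cast hs
    field_simp
    simp
  simp_rw [h1]
  rw [integral_const_mul, h, Complex.ofReal_mul, ← integral_complex_ofReal]
  congr 2
  ext x
  rw [charFun_gaussianReal]
  push_cast
  congr 1
  ring_nf

lemma lintegral_exp_neg_sq_translate {v : ℝ≥0} (hv : v ≠ 0) (x : ℝ) :
    ∫⁻ y, ENNReal.ofReal (Real.exp (-(v * (x + y) ^ 2) / 2)) =
      ENNReal.ofReal √(2 * Real.pi / v) := by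
  have h0 : (0 : ℝ) < v := by positivity
  rw [lintegral_add_left_eq_self (μ := volume)
    (fun y : ℝ => ENNReal.ofReal (Real.exp (-(v * y ^ 2) / 2))) x]
  have h : ∀ y : ℝ, Real.exp (-(v * y ^ 2) / 2) = Real.exp (-(v / 2 : ℝ) * y ^ 2) := by
    intro y; congr 1; ring
  simp_rw [h]
  rw [← ofReal_integral_eq_lintegral_ofReal (integrable_exp_neg_mul_sq (by positivity))
    (ae_of_all _ fun _ => by positivity), integral_gaussian]
  congr 2
  field_simp

/-- The product does not depend on `v`, so bounds for the damped integrals survive `v → ∞`. -/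
lemma sqrt_two_pi_mul_mul_sqrt_div {v : ℝ≥0} (hv : v ≠ 0) :
    √(2 * Real.pi * v) * √(2 * Real.pi / v) = 2 * Real.pi := by
  have h0 : (0 : ℝ) < v := by positivity
  rw [← Real.sqrt_mul (by positivity)]
  rw [show 2 * Real.pi * v * (2 * Real.pi / v) = (2 * Real.pi) ^ 2 by field_simp]
  exact Real.sqrt_sq (by positivity)

/-- Symmetrization: the squared modulus is itself a characteristic function, so `L²` questions
become applications of Parseval. -/
lemma charFun_conv_map_neg (ρ : Measure ℝ) [IsFiniteMeasure ρ] (t : ℝ) :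
    charFun (ρ.map (fun x => -x) ∗ ρ) t = ((‖charFun ρ t‖ ^ 2 : ℝ) : ℂ) := by
  have h : ρ.map (fun x => -x) = ρ.map (fun x => (-1) * x) := by simp
  rw [charFun_conv, h, charFun_map_mul, neg_one_mul, charFun_neg, mul_comm, Complex.mul_conj,
    Complex.normSq_eq_norm_sq]

lemma tendsto_exp_neg_sq_div (t : ℝ) :
    Tendsto (fun n : ℕ => Real.exp (-t ^ 2 / (2 * ((n + 1 : ℕ) : ℝ≥0)))) atTop (𝓝 1) := by
  have h : Tendsto (fun n : ℕ => (-t ^ 2 / 2) * (1 / ((n : ℝ) + 1))) atTop (𝓝 0) := by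
    simpa only [mul_zero] using
      (tendsto_one_div_add_atTop_nhds_zero_nat (𝕜 := ℝ)).const_mul (-t ^ 2 / 2)
  have := (Real.continuous_exp.tendsto 0).comp h
  rw [Real.exp_zero] at this
  refine this.congr fun n => ?_
  simp only [Function.comp]
  congr 1
  push_cast
  field_simp

/-- A Plancherel-type bound for a measure with bounded density. -/
lemma lintegral_charFun_sq_le (ρ : Measure ℝ) [IsFiniteMeasure ρ] (T : ℝ≥0)
    (h : ρ ≤ (T : ℝ≥0∞) • volume) :
    ∫⁻ t, ENNReal.ofReal (‖charFun ρ t‖ ^ 2) ≤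
      ENNReal.ofReal (2 * Real.pi) * T * ρ Set.univ := by
  have hmeas : Measurable fun t => ‖charFun ρ t‖ ^ 2 := by
    have := measurable_charFun (μ := ρ)
    fun_prop
  have key : ∀ v : ℝ≥0, v ≠ 0 →
      ∫⁻ t : ℝ, ENNReal.ofReal (‖charFun ρ t‖ ^ 2 * Real.exp (-t ^ 2 / (2 * v))) ≤
        ENNReal.ofReal (2 * Real.pi) * T * ρ Set.univ := by
    intro v hv
    have h0 : (0 : ℝ) < v := by positivity
    set τ := ρ.map (fun x => -x) ∗ ρ with hτ
    have e := integral_charFun_mul_gaussian τ hv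
    simp_rw [hτ, charFun_conv_map_neg, ← Complex.ofReal_mul, integral_complex_ofReal] at e
    have e' := Complex.ofReal_injective e
    rw [← ofReal_integral_eq_lintegral_ofReal _ (ae_of_all _ fun _ => by positivity), e',
      ENNReal.ofReal_mul (by positivity), ofReal_integral_eq_lintegral_ofReal _
        (ae_of_all _ fun _ => by positivity), Measure.lintegral_conv (by fun_prop)]
    · calc _ ≤ ENNReal.ofReal √(2 * Real.pi * v) *
            ∫⁻ x, T * ENNReal.ofReal √(2 * Real.pi / v) ∂(ρ.map fun x => -x) := by
            gcongr with x
            -- Only one of the two factors of the convolution is dominated by Lebesgue measure; the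
            -- other contributes its mass `ρ Set.univ`.
            refine (lintegral_mono' h le_rfl).trans ?_
            rw [lintegral_smul_measure, smul_eq_mul, lintegral_exp_neg_sq_translate hv]
        _ = ENNReal.ofReal (√(2 * Real.pi * v) * √(2 * Real.pi / v)) * T * ρ Set.univ := by
            rw [lintegral_const, Measure.map_apply (by fun_prop) .univ,
              ENNReal.ofReal_mul (by positivity), Set.preimage_univ]
            ring
        _ = _ := by rw [sqrt_two_pi_mul_mul_sqrt_div hv]
    · refine Integrable.of_bound (by fun_prop) 1 (ae_of_all _ fun x => ?_)
      rw [Real.norm_of_nonneg (by positivity), Real.exp_le_one_iff]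
      have : 0 ≤ v * x ^ 2 := by positivity
      linarith
    · have hg : Integrable fun t : ℝ => Real.exp (-t ^ 2 / (2 * v)) := by
        refine (integrable_exp_neg_mul_sq (b := 1 / (2 * v)) (by positivity)).congr
          (ae_of_all _ fun t => ?_)
        simp only
        congr 1
        ring
      refine hg.bdd_mul hmeas.aestronglyMeasurable (c := (ρ.real Set.univ) ^ 2)
        (ae_of_all _ fun t => ?_)
      rw [Real.norm_of_nonneg (by positivity)]
      gcongr
      exact norm_charFun_le t
  -- Fatou's lemma along `v = n + 1`, which is never zero, removes the damping.
  calc ∫⁻ t, ENNReal.ofReal (‖charFun ρ t‖ ^ 2)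
      = ∫⁻ t, liminf (fun n : ℕ => ENNReal.ofReal
          (‖charFun ρ t‖ ^ 2 * Real.exp (-t ^ 2 / (2 * ((n + 1 : ℕ) : ℝ≥0))))) atTop := by
        refine lintegral_congr fun t => (Tendsto.liminf_eq ?_).symm
        refine ENNReal.tendsto_ofReal ?_
        simpa using (tendsto_exp_neg_sq_div t).const_mul (‖charFun ρ t‖ ^ 2)
    _ ≤ liminf (fun n : ℕ => ∫⁻ t, ENNReal.ofReal
          (‖charFun ρ t‖ ^ 2 * Real.exp (-t ^ 2 / (2 * ((n + 1 : ℕ) : ℝ≥0))))) atTop :=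
        lintegral_liminf_le fun n => by fun_prop
    _ ≤ _ := liminf_le_of_frequently_le'
        (Frequently.of_forall fun n => key _ (by exact_mod_cast n.succ_ne_zero))

end Parseval

/-! ### Fourier inversion for probability measures -/

section Inversion

/-- The complex integral `∫ e^{-itx} φ(t) dt` of Fourier inversion. -/
noncomputable def inversionIntegral (φ : ℝ → ℂ) (x : ℝ) : ℂ :=
  ∫ t : ℝ, Complex.exp ((-(x * t) : ℝ) * Complex.I) * φ t

/-- The density recovered from a characteristic function `φ` by Fourier inversion. -/
noncomputable def inversionDensity (φ : ℝ → ℂ) (x : ℝ) : ℝ :=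
  (2 * Real.pi)⁻¹ * (inversionIntegral φ x).re

lemma continuous_inversionIntegral {φ : ℝ → ℂ} (hφ : Integrable φ) :
    Continuous (inversionIntegral φ) := by
  refine continuous_of_dominated (bound := fun t => ‖φ t‖) (fun x => ?_) (fun x => ?_) hφ.norm ?_
  · exact (Continuous.aestronglyMeasurable (by fun_prop)).mul hφ.1
  · refine ae_of_all _ fun t => ?_
    rw [norm_mul, Complex.norm_exp_ofReal_mul_I, one_mul]
  · exact ae_of_all _ fun t => by fun_prop

lemma continuous_inversionDensity {φ : ℝ → ℂ} (hφ : Integrable φ) :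
    Continuous (inversionDensity φ) :=
  continuous_const.mul (Complex.continuous_re.comp (continuous_inversionIntegral hφ))

lemma inversionIntegral_sub {φ ψ : ℝ → ℂ} (hφ : Integrable φ) (hψ : Integrable ψ) (x : ℝ) :
    inversionIntegral (fun t => φ t - ψ t) x =
      inversionIntegral φ x - inversionIntegral ψ x := by
  have key : ∀ {χ : ℝ → ℂ}, Integrable χ →
      Integrable fun t : ℝ => Complex.exp ((-(x * t) : ℝ) * Complex.I) * χ t := fun h =>
    h.bdd_mul (c := 1) (Continuous.aestronglyMeasurable (by fun_prop))
      (ae_of_all _ fun t => (Complex.norm_exp_ofReal_mul_I _).le)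
  unfold inversionIntegral
  rw [← integral_sub (key hφ) (key hψ)]
  simp only [mul_sub]

lemma norm_inversionIntegral_le (φ : ℝ → ℂ) (x : ℝ) :
    ‖inversionIntegral φ x‖ ≤ ∫ t, ‖φ t‖ := by
  refine (norm_integral_le_integral_norm _).trans (le_of_eq ?_)
  simp only [norm_mul, Complex.norm_exp_ofReal_mul_I, one_mul]

lemma abs_inversionDensity_sub_le {φ ψ : ℝ → ℂ} (hφ : Integrable φ) (hψ : Integrable ψ) (x : ℝ) :
    |inversionDensity φ x - inversionDensity ψ x| ≤ ∫ t, ‖φ t - ψ t‖ := by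
  unfold inversionDensity
  rw [← mul_sub, ← Complex.sub_re, ← inversionIntegral_sub hφ hψ, abs_mul, abs_of_nonneg
    (by positivity)]
  have h1 : (2 * Real.pi)⁻¹ ≤ 1 := inv_le_one_of_one_le₀ (by linarith [Real.pi_gt_three])
  calc _ ≤ 1 * |(inversionIntegral (fun t => φ t - ψ t) x).re| := by gcongr
    _ ≤ ‖inversionIntegral (fun t => φ t - ψ t) x‖ := by
        rw [one_mul]; exact Complex.abs_re_le_norm _
    _ ≤ _ := norm_inversionIntegral_le _ x

lemma abs_inversionDensity_le (φ : ℝ → ℂ) (x : ℝ) :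
    |inversionDensity φ x| ≤ ∫ t, ‖φ t‖ := by
  unfold inversionDensity
  rw [abs_mul, abs_of_nonneg (by positivity)]
  have h1 : (2 * Real.pi)⁻¹ ≤ 1 := inv_le_one_of_one_le₀ (by linarith [Real.pi_gt_three])
  calc _ ≤ 1 * |(inversionIntegral φ x).re| := by gcongr
    _ ≤ ‖inversionIntegral φ x‖ := by rw [one_mul]; exact Complex.abs_re_le_norm _
    _ ≤ _ := norm_inversionIntegral_le _ x

/-- Transfers to the inversion integral what is evident for the damped ones: they are real,
nonnegative and of mass `2π`. -/
lemma tendsto_inversionIntegral_charFun_mul_gaussian (μ : Measure ℝ)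
    (hμ : Integrable (charFun μ)) (x : ℝ) :
    Tendsto (fun n : ℕ => inversionIntegral
      (fun t => charFun μ t * (Real.exp (-t ^ 2 / (2 * ((n + 1 : ℕ) : ℝ≥0))) : ℂ)) x) atTop
      (𝓝 (inversionIntegral (charFun μ) x)) := by
  refine tendsto_integral_of_dominated_convergence (fun t => ‖charFun μ t‖) (fun n => ?_) hμ.norm
    (fun n => ?_) ?_
  · exact (Continuous.aestronglyMeasurable (by fun_prop)).mul
      (hμ.1.mul (Continuous.aestronglyMeasurable (by fun_prop)))
  · refine ae_of_all _ fun t => ?_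
    rw [norm_mul, norm_mul, Complex.norm_exp_ofReal_mul_I, one_mul, Complex.norm_real,
      Real.norm_of_nonneg (by positivity)]
    refine mul_le_of_le_one_right (norm_nonneg _) (Real.exp_le_one_iff.2 ?_)
    rw [neg_div]
    exact neg_nonpos.2 (by positivity)
  · refine ae_of_all _ fun t => ?_
    have := (Complex.continuous_ofReal.tendsto _).comp (tendsto_exp_neg_sq_div t)
    simpa using (this.const_mul (charFun μ t)).const_mul
      (Complex.exp ((-(x * t) : ℝ) * Complex.I))

variable (μ : Measure ℝ) [IsProbabilityMeasure μ]

/-- The factor `e^{-itx}` translates `μ` by `-x`, which reduces to `integral_charFun_mul_gaussian`.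
-/
lemma inversionIntegral_charFun_mul_gaussian {v : ℝ≥0} (hv : v ≠ 0) (x : ℝ) :
    inversionIntegral (fun t => charFun μ t * (Real.exp (-t ^ 2 / (2 * v)) : ℂ)) x =
      ((√(2 * Real.pi * v) * ∫ y, Real.exp (-(v * (-y + x) ^ 2) / 2) ∂μ : ℝ) : ℂ) := by
  have h := integral_charFun_mul_gaussian (μ.map (fun y => y + -x)) hv
  rw [integral_map (by fun_prop) (by fun_prop)] at h
  unfold inversionIntegral
  simp_rw [charFun_map_add_const] at h
  convert h using 1
  · congr 1
    ext t
    simp only [Real.inner_apply]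
    push_cast
    ring_nf
  · congr 3
    ext y
    congr 1
    ring

variable {μ}

lemma inversionIntegral_charFun_eq (hμ : Integrable (charFun μ)) (x : ℝ) :
    inversionIntegral (charFun μ) x = ((inversionIntegral (charFun μ) x).re : ℂ) := by
  have h := (Complex.continuous_im.tendsto _).comp
    (tendsto_inversionIntegral_charFun_mul_gaussian μ hμ x)
  have h0 : (inversionIntegral (charFun μ) x).im = 0 := by
    refine tendsto_nhds_unique h (tendsto_const_nhds.congr fun n => ?_)
    simp only [Function.comp]
    rw [inversionIntegral_charFun_mul_gaussian μ (by exact_mod_cast n.succ_ne_zero),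
      Complex.ofReal_im]
  exact Complex.ext (by simp) (by simp [h0])

lemma inversionDensity_charFun_nonneg (hμ : Integrable (charFun μ)) (x : ℝ) :
    0 ≤ inversionDensity (charFun μ) x := by
  refine mul_nonneg (by positivity) ?_
  refine ge_of_tendsto' ((Complex.continuous_re.tendsto _).comp
    (tendsto_inversionIntegral_charFun_mul_gaussian μ hμ x)) fun n => ?_
  simp only [Function.comp]
  rw [inversionIntegral_charFun_mul_gaussian μ (by exact_mod_cast n.succ_ne_zero),
    Complex.ofReal_re]
  have : 0 ≤ ∫ y, Real.exp (-((((n + 1 : ℕ) : ℝ≥0) : ℝ) * (-y + x) ^ 2) / 2) ∂μ :=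
    integral_nonneg fun _ => by positivity
  positivity

/-- By Tonelli each damped integral has mass exactly `2π`; Fatou keeps the inequality, which
suffices for integrability. -/
lemma lintegral_inversionIntegral_le (hμ : Integrable (charFun μ)) :
    ∫⁻ x, ENNReal.ofReal (inversionIntegral (charFun μ) x).re ≤ ENNReal.ofReal (2 * Real.pi) := by
  have key : ∀ v : ℝ≥0, v ≠ 0 →
      ∫⁻ x, ENNReal.ofReal (√(2 * Real.pi * v) * ∫ y, Real.exp (-(v * (-y + x) ^ 2) / 2) ∂μ) =
        ENNReal.ofReal (2 * Real.pi) := by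
    intro v hv
    have e : ∀ x, ENNReal.ofReal
        (√(2 * Real.pi * v) * ∫ y, Real.exp (-(v * (-y + x) ^ 2) / 2) ∂μ) =
        ENNReal.ofReal √(2 * Real.pi * v) *
          ∫⁻ y, ENNReal.ofReal (Real.exp (-(v * (-y + x) ^ 2) / 2)) ∂μ := by
      intro x
      rw [ENNReal.ofReal_mul (by positivity), ofReal_integral_eq_lintegral_ofReal _
        (ae_of_all _ fun _ => by positivity)]
      refine Integrable.of_bound (by fun_prop) 1 (ae_of_all _ fun y => ?_)
      rw [Real.norm_of_nonneg (by positivity), Real.exp_le_one_iff]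
      have : 0 ≤ v * (-y + x) ^ 2 := by positivity
      linarith
    simp_rw [e]
    rw [lintegral_const_mul' _ _ ENNReal.ofReal_ne_top, lintegral_lintegral_swap
      (by fun_prop)]
    simp_rw [lintegral_exp_neg_sq_translate hv]
    rw [lintegral_const, measure_univ, mul_one, ← ENNReal.ofReal_mul (by positivity),
      sqrt_two_pi_mul_mul_sqrt_div hv]
  calc ∫⁻ x, ENNReal.ofReal (inversionIntegral (charFun μ) x).re
      = ∫⁻ x, liminf (fun n : ℕ => ENNReal.ofReal (√(2 * Real.pi * ((n + 1 : ℕ) : ℝ≥0)) *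
          ∫ y, Real.exp (-((((n + 1 : ℕ) : ℝ≥0) : ℝ) * (-y + x) ^ 2) / 2) ∂μ)) atTop := by
        refine lintegral_congr fun x => (Tendsto.liminf_eq ?_).symm
        refine ENNReal.tendsto_ofReal ?_
        refine ((Complex.continuous_re.tendsto _).comp
          (tendsto_inversionIntegral_charFun_mul_gaussian μ hμ x)).congr fun n => ?_
        simp only [Function.comp]
        rw [inversionIntegral_charFun_mul_gaussian μ (by exact_mod_cast n.succ_ne_zero),
          Complex.ofReal_re]
    _ ≤ liminf (fun n : ℕ => ∫⁻ x, ENNReal.ofReal (√(2 * Real.pi * ((n + 1 : ℕ) : ℝ≥0)) *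
          ∫ y, Real.exp (-((((n + 1 : ℕ) : ℝ≥0) : ℝ) * (-y + x) ^ 2) / 2) ∂μ)) atTop := by
        refine lintegral_liminf_le fun n => ?_
        have : Continuous fun x : ℝ =>
            ∫ y, Real.exp (-((((n + 1 : ℕ) : ℝ≥0) : ℝ) * (-y + x) ^ 2) / 2) ∂μ := by
          refine continuous_of_dominated (bound := fun _ => 1) (fun x => by fun_prop)
            (fun x => ae_of_all _ fun y => ?_) (integrable_const _)
            (ae_of_all _ fun y => by fun_prop)
          rw [Real.norm_of_nonneg (by positivity), Real.exp_le_one_iff]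
          have : 0 ≤ (((n + 1 : ℕ) : ℝ≥0) : ℝ) * (-y + x) ^ 2 := by positivity
          linarith
        exact (this.measurable.const_mul _).ennreal_ofReal
    _ ≤ _ := liminf_le_of_frequently_le'
        (Frequently.of_forall fun n => (key _ (by exact_mod_cast n.succ_ne_zero)).le)

lemma integrable_inversionIntegral_charFun (hμ : Integrable (charFun μ)) :
    Integrable (inversionIntegral (charFun μ)) := by
  have h1 : Integrable fun x => (inversionIntegral (charFun μ) x).re := by
    refine ⟨(Complex.continuous_re.comp
      (continuous_inversionIntegral hμ)).aestronglyMeasurable, ?_⟩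
    rw [hasFiniteIntegral_iff_ofReal]
    · exact (lintegral_inversionIntegral_le hμ).trans_lt ENNReal.ofReal_lt_top
    · refine ae_of_all _ fun x => ?_
      have := inversionDensity_charFun_nonneg hμ x
      exact (mul_nonneg_iff_of_pos_left (by positivity)).1 this
  exact h1.ofReal.congr (ae_of_all _ fun x => (inversionIntegral_charFun_eq hμ x).symm)

lemma integral_exp_mul_inversionIntegral (hμ : Integrable (charFun μ)) (s : ℝ) :
    (2 * Real.pi : ℂ)⁻¹ * ∫ x : ℝ, Complex.exp (s * x * Complex.I) *
      inversionIntegral (charFun μ) x = charFun μ s := by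
  have hπ : (2 * Real.pi) ≠ 0 := by positivity
  -- The inversion theorem puts `2π` in the exponent, hence the rescaling of the argument.
  have hF : ∀ w, FourierTransform.fourier (charFun μ) w =
      inversionIntegral (charFun μ) (w * (2 * Real.pi)) := by
    intro w
    rw [Real.fourier_real_eq_integral_exp_smul]
    unfold inversionIntegral
    congr 1
    ext t
    rw [smul_eq_mul]
    congr 3
    push_cast
    ring
  have hFi : Integrable (FourierTransform.fourier (charFun μ)) := by
    rw [show FourierTransform.fourier (charFun μ) = _ from funext hF]
    exact (integrable_inversionIntegral_charFun hμ).comp_mul_right' hπ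
  have h := congrFun (Continuous.fourierInv_fourier_eq continuous_charFun hμ hFi) s
  rw [← h, Real.fourierInv_eq']
  have e := Measure.integral_comp_mul_right (fun x : ℝ => Complex.exp (s * x * Complex.I) *
      inversionIntegral (charFun μ) x) (2 * Real.pi)
  rw [abs_of_pos (by positivity), Complex.real_smul] at e
  push_cast at e
  rw [← e]
  congr 1
  ext t
  rw [hF, smul_eq_mul, Real.inner_apply]
  congr 3
  push_cast
  ring

lemma integrable_inversionDensity_charFun (hμ : Integrable (charFun μ)) :
    Integrable (inversionDensity (charFun μ)) :=
  (integrable_inversionIntegral_charFun hμ).re.const_mul _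

/-- Fourier inversion: a probability measure with integrable characteristic function has the
continuous density given by the inversion formula. -/
theorem eq_withDensity_inversionDensity (hμ : Integrable (charFun μ)) :
    μ = volume.withDensity (fun x => ENNReal.ofReal (inversionDensity (charFun μ) x)) := by
  have hint := integrable_inversionDensity_charFun hμ
  have hmeas : Measurable fun x => ENNReal.ofReal (inversionDensity (charFun μ) x) :=
    (continuous_inversionDensity hμ).measurable.ennreal_ofReal
  have : IsFiniteMeasure
      (volume.withDensity (fun x => ENNReal.ofReal (inversionDensity (charFun μ) x))) :=
    isFiniteMeasure_withDensity_ofReal hint.2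
  refine Measure.ext_of_charFun (funext fun s => ?_)
  rw [← integral_exp_mul_inversionIntegral hμ s, charFun_apply_real,
    integral_withDensity_eq_integral_toReal_smul hmeas (ae_of_all _ fun _ => ENNReal.ofReal_lt_top),
    ← integral_const_mul]
  congr 1
  ext x
  rw [ENNReal.toReal_ofReal (inversionDensity_charFun_nonneg hμ x), Complex.real_smul,
    inversionIntegral_charFun_eq hμ x, inversionDensity]
  push_cast
  ring

end Inversion

/-! ### Densities in `L^r` and powers of the characteristic function -/

section HighLevelSets

variable {μ : Measure ℝ} {p : ℝ → ℝ≥0∞} {r C : ℝ}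

lemma restrict_le_smul_of_withDensity (hp : Measurable p) (hμ : μ = volume.withDensity p)
    (T : ℝ≥0) : μ.restrict {x | p x ≤ T} ≤ (T : ℝ≥0∞) • volume := by
  have hA : MeasurableSet {x | p x ≤ T} := measurableSet_le hp measurable_const
  rw [hμ, restrict_withDensity hA]
  calc _ ≤ (volume.restrict {x | p x ≤ T}).withDensity fun _ => (T : ℝ≥0∞) :=
        withDensity_mono ((ae_restrict_iff' hA).2 (ae_of_all _ fun x hx => hx))
    _ = (T : ℝ≥0∞) • volume.restrict {x | p x ≤ T} := withDensity_const _
    _ ≤ _ := by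
        gcongr
        exact Measure.restrict_le_self

/-- Markov's inequality: where `p > T`, `T^(r-1) p ≤ p^r`. -/
lemma rpow_mul_measure_compl_le (hp : Measurable p) (hμ : μ = volume.withDensity p)
    (hr : 1 < r) (T : ℝ≥0) :
    (T : ℝ≥0∞) ^ (r - 1) * μ {x | p x ≤ T}ᶜ ≤ ∫⁻ x, p x ^ r := by
  have hA : MeasurableSet {x | p x ≤ T} := measurableSet_le hp measurable_const
  rw [hμ, withDensity_apply _ hA.compl, ← lintegral_const_mul _ hp]
  calc _ ≤ ∫⁻ x in {x | p x ≤ T}ᶜ, p x ^ r := by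
        refine setLIntegral_mono (hp.pow_const _) fun x hx => ?_
        have hx' : (T : ℝ≥0∞) < p x := not_le.1 hx
        calc (T : ℝ≥0∞) ^ (r - 1) * p x ≤ p x ^ (r - 1) * p x ^ (1 : ℝ) := by
              rw [ENNReal.rpow_one]
              gcongr
          _ = p x ^ r := by
              rw [← ENNReal.rpow_add_of_nonneg _ _ (by linarith) zero_le_one, sub_add_cancel]
    _ ≤ _ := setLIntegral_le_lintegral _ _

variable [IsProbabilityMeasure μ]

/-- Weak-type bound for the characteristic function of a measure with density in `L^r`. -/
lemma volume_lt_norm_charFun_le (hp : Measurable p) (hμ : μ = volume.withDensity p)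
    (hr : 1 < r) (hC : 0 < C) (hpC : ∫⁻ x, p x ^ r ≤ ENNReal.ofReal C) {l : ℝ} (hl : 0 < l) :
    volume {t | l < ‖charFun μ t‖} ≤
      ENNReal.ofReal (8 * Real.pi * (2 * C) ^ (1 / (r - 1)) * l ^ (-(2 + 1 / (r - 1)))) := by
  have hr' : 0 < r - 1 := by linarith
  -- The height solves `C / T^(r-1) = l / 2`, so the part of `μ` above it moves the characteristic
  -- function by at most `l / 2`.
  set T : ℝ≥0 := Real.toNNReal ((2 * C / l) ^ (1 / (r - 1)))
  have hT' : (T : ℝ) = (2 * C / l) ^ (1 / (r - 1)) := Real.coe_toNNReal _ (by positivity)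
  set A := {x | p x ≤ T}
  have hA : MeasurableSet A := measurableSet_le hp measurable_const
  have hsmall : (μ.restrict Aᶜ).real Set.univ ≤ l / 2 := by
    have h := (rpow_mul_measure_compl_le hp hμ hr T).trans hpC
    have hTr : (T : ℝ≥0∞) ^ (r - 1) = ENNReal.ofReal (2 * C / l) := by
      rw [← ENNReal.ofReal_coe_nnreal, ENNReal.ofReal_rpow_of_nonneg NNReal.zero_le_coe hr'.le, hT',
        ← Real.rpow_mul (by positivity), one_div_mul_cancel hr'.ne', Real.rpow_one]
    rw [hTr, ← ofReal_measureReal, ← ENNReal.ofReal_mul (by positivity),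
      ENNReal.ofReal_le_ofReal_iff hC.le] at h
    rw [measureReal_restrict_apply_univ]
    rw [div_mul_eq_mul_div, div_le_iff₀ hl] at h
    have : 2 * μ.real Aᶜ ≤ l := by
      refine le_of_mul_le_mul_left ?_ hC
      linarith
    linarith
  have hadd : ∀ t, charFun μ t = charFun (μ.restrict A) t + charFun (μ.restrict Aᶜ) t := by
    intro t
    simp only [charFun_apply_real]
    refine (integral_add_compl hA (Integrable.of_bound (by fun_prop) 1
      (ae_of_all _ fun x => le_of_eq ?_))).symm
    rw [← Complex.ofReal_mul, Complex.norm_exp_ofReal_mul_I]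
  -- The low part must then exceed `l / 2`, and Chebyshev in `L²` applies: `2πT / (l²/4)` is the
  -- source of `8π`.
  have hsub : {t | l < ‖charFun μ t‖} ⊆
      {t | ENNReal.ofReal (l ^ 2 / 4) ≤ ENNReal.ofReal (‖charFun (μ.restrict A) t‖ ^ 2)} := by
    intro t ht
    simp only [Set.mem_ofPred_eq] at ht ⊢
    refine ENNReal.ofReal_le_ofReal ?_
    have h1 : ‖charFun μ t‖ ≤ ‖charFun (μ.restrict A) t‖ + l / 2 := by
      rw [hadd t]
      exact (norm_add_le _ _).trans (by gcongr; exact (norm_charFun_le t).trans hsmall)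
    have h2 : l / 2 ≤ ‖charFun (μ.restrict A) t‖ := by linarith
    calc l ^ 2 / 4 = (l / 2) ^ 2 := by ring
      _ ≤ _ := by gcongr
  have hmeas : Measurable fun t => ENNReal.ofReal (‖charFun (μ.restrict A) t‖ ^ 2) := by
    have := measurable_charFun (μ := μ.restrict A)
    fun_prop
  have hpl := lintegral_charFun_sq_le (μ.restrict A) T (restrict_le_smul_of_withDensity hp hμ T)
  have hmk := (mul_meas_ge_le_lintegral (μ := volume) hmeas (ENNReal.ofReal (l ^ 2 / 4))).trans hpl
  have hρ : (μ.restrict A) Set.univ ≤ 1 := by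
    rw [Measure.restrict_apply_univ]
    exact prob_le_one
  have hfin : ENNReal.ofReal (l ^ 2 / 4) *
      volume {t | l < ‖charFun μ t‖} ≤ ENNReal.ofReal (2 * Real.pi * T) := by
    calc _ ≤ _ := mul_le_mul_right (measure_mono hsub) _
      _ ≤ _ := hmk
      _ ≤ ENNReal.ofReal (2 * Real.pi) * T * 1 := by gcongr
      _ = _ := by
        rw [mul_one, ENNReal.ofReal_mul (p := 2 * Real.pi) (by positivity),
          ENNReal.ofReal_coe_nnreal]
  have hl0 : ENNReal.ofReal (l ^ 2 / 4) ≠ 0 := by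
    rw [Ne, ENNReal.ofReal_eq_zero, not_le]; positivity
  rw [mul_comm, ← ENNReal.le_div_iff_mul_le (Or.inl hl0) (Or.inl ENNReal.ofReal_ne_top),
    ← ENNReal.ofReal_div_of_pos (by positivity)] at hfin
  refine hfin.trans (le_of_eq ?_)
  congr 1
  rw [hT', Real.div_rpow (by positivity) hl.le, neg_add, Real.rpow_add hl, Real.rpow_neg hl.le,
    Real.rpow_neg hl.le]
  have : 0 < l ^ (1 / (r - 1)) := by positivity
  norm_num
  field_simp
  norm_num

/-- If a probability measure has a density in `L^r` for some `r > 1`, then some power of its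
characteristic function is integrable. -/
theorem exists_integrable_norm_charFun_pow (hp : Measurable p) (hμ : μ = volume.withDensity p)
    (hr : 1 < r) (hpr : ∫⁻ x, p x ^ r ≠ ∞) :
    ∃ k : ℕ, 1 ≤ k ∧ Integrable fun t => ‖charFun μ t‖ ^ k := by
  have hr' : 0 < r - 1 := by linarith
  set C : ℝ := (∫⁻ x, p x ^ r).toReal + 1
  have hC : 0 < C := by positivity
  have hpC : ∫⁻ x, p x ^ r ≤ ENNReal.ofReal C := by
    rw [← ENNReal.ofReal_toReal hpr]
    exact ENNReal.ofReal_le_ofReal (by simp [C])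
  set s : ℝ := 2 + 1 / (r - 1) with hs
  set K : ℝ := 8 * Real.pi * (2 * C) ^ (1 / (r - 1)) with hK
  -- With `k - 1 ≥ s` the layer-cake integrand is at most `K` on `(0, 1]`; above level 1 the level
  -- sets are empty.
  obtain ⟨k, hk⟩ := exists_nat_ge (s + 1)
  have hs0 : 0 < s := by positivity
  have hk0 : (0 : ℝ) < k := by linarith
  have hmeas : Measurable fun t => ‖charFun μ t‖ := measurable_charFun.norm
  refine ⟨k, by exact_mod_cast hk0, (hmeas.pow_const k).aestronglyMeasurable, ?_⟩
  rw [hasFiniteIntegral_iff_ofReal (ae_of_all _ fun _ => by positivity)]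
  have hcake := lintegral_rpow_eq_lintegral_meas_lt_mul volume
    (f := fun t => ‖charFun μ t‖) (ae_of_all _ fun _ => norm_nonneg _) hmeas.aemeasurable hk0
  simp only [Real.rpow_natCast] at hcake
  rw [hcake]
  refine ENNReal.mul_lt_top ENNReal.ofReal_lt_top ?_
  calc _ ≤ ∫⁻ l in Set.Ioi 0, (Set.Ioc (0 : ℝ) 1).indicator (fun _ => ENNReal.ofReal K) l := by
        refine setLIntegral_mono (measurable_const.indicator measurableSet_Ioc) fun l hl => ?_
        have hl : 0 < l := hl
        by_cases h1 : l ≤ 1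
        · rw [Set.indicator_of_mem (Set.mem_Ioc.2 ⟨hl, h1⟩)]
          calc _ ≤ ENNReal.ofReal (K * l ^ (-s)) * ENNReal.ofReal (l ^ ((k : ℝ) - 1)) := by
                gcongr
                exact volume_lt_norm_charFun_le hp hμ hr hC hpC hl
            _ = ENNReal.ofReal (K * l ^ ((k : ℝ) - 1 - s)) := by
                rw [← ENNReal.ofReal_mul (by positivity), mul_assoc, ← Real.rpow_add hl]
                congr 3
                ring
            _ ≤ _ := by
                refine ENNReal.ofReal_le_ofReal (mul_le_of_le_one_right (by positivity) ?_)
                exact Real.rpow_le_one hl.le h1 (by linarith)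
        · have : {a | l < ‖charFun μ a‖} = ∅ := by
            ext a
            simp only [Set.mem_ofPred_eq, Set.mem_empty_iff_false, iff_false, not_lt]
            exact (norm_charFun_le_one a).trans (le_of_lt (not_le.1 h1))
          rw [this, measure_empty, zero_mul]
          exact zero_le
    _ ≤ ∫⁻ l, (Set.Ioc (0 : ℝ) 1).indicator (fun _ => ENNReal.ofReal K) l :=
        setLIntegral_le_lintegral _ _
    _ < ∞ := by
        rw [lintegral_indicator measurableSet_Ioc, setLIntegral_const]
        simp

end HighLevelSets

/-! ### Characteristic functions away from the origin -/

section CharFunBounds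

variable (μ : Measure ℝ) [IsProbabilityMeasure μ]

/-- Convolution powers let results for integrable characteristic functions apply when only a power
is integrable. -/
lemma exists_charFun_eq_pow (m : ℕ) :
    ∃ κ : Measure ℝ, IsProbabilityMeasure κ ∧ charFun κ = fun t => charFun μ t ^ m := by
  induction m with
  | zero => exact ⟨Measure.dirac 0, inferInstance, by ext t; simp [charFun_dirac]⟩
  | succ m ih =>
    obtain ⟨κ, _, h⟩ := ih
    refine ⟨κ ∗ μ, inferInstance, funext fun t => ?_⟩
    rw [charFun_conv, h, pow_succ]

variable {μ} in
/-- Riemann-Lebesgue lemma for measures with integrable characteristic function. -/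
lemma tendsto_charFun_cocompact (hμ : Integrable (charFun μ)) :
    Tendsto (charFun μ) (cocompact ℝ) (𝓝 0) := by
  -- By inversion, `charFun μ` is a rescaled Fourier transform of this function.
  have h := Real.tendsto_integral_exp_smul_cocompact (inversionIntegral (charFun μ))
  have hne : -(2 * Real.pi)⁻¹ ≠ 0 := neg_ne_zero.2 (by positivity)
  have hc := (Homeomorph.mulLeft₀ (-(2 * Real.pi)⁻¹) hne).isClosedEmbedding.tendsto_cocompact
  have h2 := (h.comp hc).const_mul ((2 * Real.pi : ℂ)⁻¹)
  rw [mul_zero] at h2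
  refine h2.congr fun s => ?_
  rw [← integral_exp_mul_inversionIntegral hμ s]
  simp only [Function.comp, Homeomorph.coe_mulLeft₀]
  congr 2
  ext x
  rw [Circle.smul_def, Real.fourierChar_apply, smul_eq_mul]
  congr 2
  push_cast
  have : (Real.pi : ℂ) ≠ 0 := by exact_mod_cast Real.pi_ne_zero
  field_simp

variable {μ} in
lemma tendsto_norm_charFun_cocompact {m : ℕ} (hm : m ≠ 0)
    (hμ : Integrable fun t => ‖charFun μ t‖ ^ m) :
    Tendsto (fun t => ‖charFun μ t‖) (cocompact ℝ) (𝓝 0) := by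
  obtain ⟨κ, _, h⟩ := exists_charFun_eq_pow μ m
  have hκ : Integrable (charFun κ) := by
    rw [← integrable_norm_iff measurable_charFun.aestronglyMeasurable, h]
    simpa only [norm_pow] using hμ
  have h1 := (tendsto_charFun_cocompact hκ).norm
  simp only [h, norm_zero, norm_pow] at h1
  have h2 := ((Real.continuous_rpow_const (q := (m : ℝ)⁻¹) (by positivity)).tendsto 0).comp h1
  rw [Real.zero_rpow (by positivity)] at h2
  exact h2.congr fun t => Real.pow_rpow_inv_natCast (norm_nonneg _) hm

lemma norm_charFun_sq_eq_integral_cos (t : ℝ) :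
    ‖charFun μ t‖ ^ 2 = ∫ x, Real.cos (t * x) ∂(μ.map (fun x => -x) ∗ μ) := by
  have h := congrArg Complex.re (charFun_conv_map_neg μ t)
  rw [Complex.ofReal_re] at h
  rw [← h, charFun_apply_real]
  have : IsProbabilityMeasure (μ.map (fun x => -x)) :=
    Measure.isProbabilityMeasure_map (by fun_prop)
  have hint : Integrable (fun x : ℝ => Complex.exp (t * x * Complex.I))
      (μ.map (fun x => -x) ∗ μ) := by
    refine Integrable.of_bound (by fun_prop) 1 (ae_of_all _ fun x => le_of_eq ?_)
    rw [← Complex.ofReal_mul, Complex.norm_exp_ofReal_mul_I]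
  rw [show (∫ x : ℝ, Complex.exp (t * x * Complex.I) ∂(μ.map (fun x => -x) ∗ μ)).re =
    RCLike.re (∫ x : ℝ, Complex.exp (t * x * Complex.I) ∂(μ.map (fun x => -x) ∗ μ)) from rfl,
    ← integral_re hint]
  congr 1
  ext x
  rw [← Complex.ofReal_mul]
  exact Complex.exp_ofReal_mul_I_re _

/-- Integrate `1 - cos 2u ≤ 4 (1 - cos u)`, that is `2 (1 - cos u)² ≥ 0`, against the symmetrized
law. -/
lemma one_sub_norm_charFun_sq_two_mul_le (t : ℝ) :
    1 - ‖charFun μ (2 * t)‖ ^ 2 ≤ 4 * (1 - ‖charFun μ t‖ ^ 2) := by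
  rw [norm_charFun_sq_eq_integral_cos, norm_charFun_sq_eq_integral_cos]
  set τ := μ.map (fun x => -x) ∗ μ
  have : IsProbabilityMeasure (μ.map (fun x => -x)) :=
    Measure.isProbabilityMeasure_map (by fun_prop)
  have hint : ∀ s : ℝ, Integrable (fun x => Real.cos (s * x)) τ := fun s =>
    Integrable.of_bound (by fun_prop) 1 (ae_of_all _ fun x => Real.abs_cos_le_one _)
  have h1 : ∀ s : ℝ, 1 - ∫ x, Real.cos (s * x) ∂τ = ∫ x, (1 - Real.cos (s * x)) ∂τ := by
    intro s
    rw [integral_sub (integrable_const _) (hint s)]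
    simp
  rw [h1, h1, ← integral_const_mul]
  refine integral_mono ((integrable_const _).sub (hint _))
    (((integrable_const _).sub (hint _)).const_mul _) fun x => ?_
  simp only
  rw [show 2 * t * x = 2 * (t * x) by ring, Real.cos_two_mul]
  nlinarith [sq_nonneg (Real.cos (t * x) - 1)]

lemma one_sub_norm_charFun_sq_two_pow_mul_le (k : ℕ) (t : ℝ) :
    1 - ‖charFun μ (2 ^ k * t)‖ ^ 2 ≤ 4 ^ k * (1 - ‖charFun μ t‖ ^ 2) := by
  induction k with
  | zero => simp
  | succ k ih =>
    have := one_sub_norm_charFun_sq_two_mul_le μ (2 ^ k * t)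
    rw [show (2 : ℝ) ^ (k + 1) * t = 2 * (2 ^ k * t) by ring, pow_succ' (4 : ℝ), mul_assoc]
    linarith

variable {μ} in
/-- A characteristic function vanishing at infinity is bounded away from `1` in absolute value
outside each neighbourhood of `0`. -/
lemma exists_norm_charFun_le_lt_one
    (hμ : Tendsto (fun t => ‖charFun μ t‖) (cocompact ℝ) (𝓝 0)) {δ : ℝ} (hδ : 0 < δ) :
    ∃ η : ℝ, 0 < η ∧ η < 1 ∧ ∀ t, δ ≤ |t| → ‖charFun μ t‖ ≤ η := by
  have h1 := hμ.eventually (gt_mem_nhds (show (0 : ℝ) < 1 / 2 by norm_num))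
  rw [← Metric.cobounded_eq_cocompact, (Metric.hasBasis_cobounded_compl_closedBall 0).eventually_iff]
    at h1
  obtain ⟨R, -, hR⟩ := h1
  -- Doubling `k` times carries every `|t| ≥ δ` beyond `R`, where the modulus is below `1/2`; hence
  -- `1/2 ≤ 4^k (1 - ‖charFun μ t‖²)`, which dictates `η`.
  obtain ⟨k, hk⟩ := pow_unbounded_of_one_lt (R / δ) (show (1 : ℝ) < 2 by norm_num)
  rw [div_lt_iff₀ hδ] at hk
  have h4 : (1 : ℝ) ≤ 4 ^ k := one_le_pow₀ (by norm_num)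
  have hle : 1 / (2 * (4 : ℝ) ^ k) ≤ 1 / 2 := by
    apply one_div_le_one_div_of_le <;> linarith
  have hpos : 0 < 1 / (2 * (4 : ℝ) ^ k) := by positivity
  refine ⟨√(1 - 1 / (2 * 4 ^ k)), Real.sqrt_pos.2 (by linarith), ?_, fun t ht => ?_⟩
  · rw [Real.sqrt_lt' one_pos]
    linarith
  · apply Real.le_sqrt_of_sq_le
    have h2 := one_sub_norm_charFun_sq_two_pow_mul_le μ k t
    have h3 : ‖charFun μ (2 ^ k * t)‖ < 1 / 2 := by
      refine hR ?_
      simp only [Set.mem_compl_iff, Metric.mem_closedBall, dist_zero_right, not_le, norm_mul,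
        norm_pow, Real.norm_eq_abs, Nat.abs_ofNat]
      exact hk.trans_le (by gcongr)
    have h5 : ‖charFun μ (2 ^ k * t)‖ ^ 2 ≤ 1 / 2 := by
      nlinarith [norm_nonneg (charFun μ (2 ^ k * t))]
    have h6 : 1 / (2 * (4 : ℝ) ^ k) ≤ 1 - ‖charFun μ t‖ ^ 2 := by
      rw [div_le_iff₀ (by positivity)]
      linarith
    linarith

end CharFunBounds

/-! ### Convergence of characteristic functions in `L¹` -/

section CharFunConvergence

lemma norm_cexp_neg_sq_div_two (t : ℝ) :
    ‖Complex.exp (-(t : ℂ) ^ 2 / 2)‖ = Real.exp (-(1 / 2) * t ^ 2) := by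
  rw [Complex.norm_exp]
  congr 1
  rw [show -(t : ℂ) ^ 2 / 2 = ((-(1 / 2) * t ^ 2 : ℝ) : ℂ) by push_cast; ring, Complex.ofReal_re]

/-- A Taylor error of at most `t²/4` leaves `‖φ t‖ ≤ 1 - t²/4 ≤ e^(-t²/4)`. -/
lemma exists_norm_le_exp_neg_sq_div_four {φ : ℝ → ℂ}
    (h : (fun t : ℝ => φ t - (1 - (t : ℂ) ^ 2 / 2)) =o[𝓝 0] fun t => t ^ 2) :
    ∃ δ : ℝ, 0 < δ ∧ ∀ t, |t| ≤ δ → ‖φ t‖ ≤ Real.exp (-t ^ 2 / 4) := by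
  have h1 := h.def (show (0 : ℝ) < 1 / 4 by norm_num)
  obtain ⟨ε, hε, hb⟩ := Metric.eventually_nhds_iff.1 h1
  refine ⟨min (ε / 2) 1, by positivity, fun t ht => ?_⟩
  have ht1 : |t| ≤ 1 := ht.trans (min_le_right _ _)
  have ht2 : |t| ≤ ε / 2 := ht.trans (min_le_left _ _)
  have h2 := @hb t (by rw [dist_zero_right, Real.norm_eq_abs]; linarith)
  have hsq : t ^ 2 ≤ 1 := by rw [← sq_abs]; nlinarith [abs_nonneg t]
  have h3 : ‖(1 - (t : ℂ) ^ 2 / 2)‖ = 1 - t ^ 2 / 2 := by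
    rw [show (1 - (t : ℂ) ^ 2 / 2) = ((1 - t ^ 2 / 2 : ℝ) : ℂ) by push_cast; rfl,
      Complex.norm_real, Real.norm_of_nonneg (by linarith)]
  rw [Real.norm_of_nonneg (sq_nonneg t)] at h2
  have h4 : ‖φ t‖ ≤ ‖φ t - (1 - (t : ℂ) ^ 2 / 2)‖ + ‖(1 - (t : ℂ) ^ 2 / 2)‖ := by
    exact norm_le_norm_sub_add _ _
  have h5 := Real.add_one_le_exp (-t ^ 2 / 4)
  linarith

/-- Spend `m` of the `n` factors on integrability and bound the others by `η`; rescaling costs `√n`,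
which `η^(n-m)` beats. -/
lemma tendsto_integral_norm_indicator_compl {μ : Measure ℝ} {δ η : ℝ} (hη0 : 0 < η)
    (hη1 : η < 1) {m : ℕ}
    (hη : ∀ t, δ ≤ |t| → ‖charFun μ t‖ ≤ η) (hm : Integrable fun t => ‖charFun μ t‖ ^ m) :
    Tendsto (fun n : ℕ => ∫ t : ℝ, ‖{t : ℝ | |(√n)⁻¹ * t| ≤ δ}ᶜ.indicator
      (fun t => charFun μ ((√n)⁻¹ * t) ^ n) t‖) atTop (𝓝 0) := by
  have hlim : Tendsto (fun n : ℕ => ((n : ℝ) ^ 1 * η ^ n) *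
      ((η ^ m)⁻¹ * ∫ t, ‖charFun μ t‖ ^ m)) atTop (𝓝 0) := by
    simpa only [zero_mul] using (tendsto_pow_const_mul_const_pow_of_abs_lt_one 1
      (by rwa [abs_of_pos hη0])).mul_const ((η ^ m)⁻¹ * ∫ t, ‖charFun μ t‖ ^ m)
  refine squeeze_zero' (Eventually.of_forall fun n => integral_nonneg fun _ => norm_nonneg _) ?_
    hlim
  filter_upwards [eventually_ge_atTop (m + 1)] with n hn
  have hn1 : (1 : ℝ) ≤ n := by exact_mod_cast (by omega : 1 ≤ n)
  have hs : (√(n : ℝ))⁻¹ ≠ 0 := by positivity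
  have hI : 0 ≤ ∫ t, ‖charFun μ t‖ ^ m := integral_nonneg fun _ => by positivity
  calc _ ≤ ∫ t : ℝ, η ^ (n - m) * ‖charFun μ ((√n)⁻¹ * t)‖ ^ m := by
        refine integral_mono_of_nonneg (ae_of_all _ fun _ => norm_nonneg _)
          ((hm.comp_mul_left' hs).const_mul _) (ae_of_all _ fun t => ?_)
        simp only
        by_cases ht : |(√n)⁻¹ * t| ≤ δ
        · rw [Set.indicator_of_notMem (by simpa using ht), norm_zero]
          positivity
        · rw [Set.indicator_of_mem (by exact ht), norm_pow,
            show n = (n - m) + m by omega, pow_add, Nat.add_sub_cancel]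
          gcongr
          rw [Nat.sub_add_cancel (by omega)]
          exact hη _ (le_of_lt (not_le.1 ht))
    _ = √n * (η ^ (n - m) * ∫ t, ‖charFun μ t‖ ^ m) := by
        rw [integral_const_mul, Measure.integral_comp_mul_left (fun t => ‖charFun μ t‖ ^ m),
          inv_inv, abs_of_nonneg (by positivity), smul_eq_mul]
        ring
    _ ≤ n * (η ^ (n - m) * ∫ t, ‖charFun μ t‖ ^ m) := by
        gcongr
        exact Real.sqrt_le_iff.2 ⟨by positivity, by nlinarith⟩
    _ = _ := by
        rw [pow_sub₀ _ hη0.ne' (by omega)]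
        ring

variable {μ : Measure ℝ} [IsProbabilityMeasure μ]

/-- Dominated convergence: the `n`-th power of `e^(-(t/√n)²/4)` is `e^(-t²/4)` for every `n > 0`,
and each fixed `t` eventually lies in the window. -/
lemma tendsto_integral_norm_indicator_sub {δ : ℝ} (hδ : 0 < δ)
    (hexp : ∀ t, |t| ≤ δ → ‖charFun μ t‖ ≤ Real.exp (-t ^ 2 / 4))
    (hlim : ∀ t : ℝ, Tendsto (fun n : ℕ => charFun μ ((√n)⁻¹ * t) ^ n) atTop
      (𝓝 (Complex.exp (-t ^ 2 / 2)))) :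
    Tendsto (fun n : ℕ => ∫ t : ℝ, ‖{t : ℝ | |(√n)⁻¹ * t| ≤ δ}.indicator
      (fun t => charFun μ ((√n)⁻¹ * t) ^ n) t - Complex.exp (-t ^ 2 / 2)‖) atTop (𝓝 0) := by
  have hmeas := measurable_charFun (μ := μ)
  have hset : ∀ n : ℕ, MeasurableSet {t : ℝ | |(√n)⁻¹ * t| ≤ δ} := fun n =>
    measurableSet_le (by fun_prop) measurable_const
  have key := tendsto_integral_filter_of_dominated_convergence (μ := (volume : Measure ℝ))
    (l := atTop)
    (F := fun (n : ℕ) t => ‖{t : ℝ | |(√n)⁻¹ * t| ≤ δ}.indicator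
      (fun t => charFun μ ((√n)⁻¹ * t) ^ n) t - Complex.exp (-t ^ 2 / 2)‖) (f := fun _ => 0)
    (fun t => 1 * Real.exp (-(1 / 4) * t ^ 2) + Real.exp (-(1 / 2) * t ^ 2))
    (Eventually.of_forall fun n => ?_)
    ((eventually_gt_atTop 0).mono fun n hn => ?_) ?_ ?_
  · simpa using key
  · refine (Measurable.aestronglyMeasurable ?_)
    exact (((by fun_prop : Measurable fun t => charFun μ ((√n)⁻¹ * t) ^ n).indicator
      (hset n)).sub (by fun_prop)).norm
  · refine ae_of_all _ fun t => ?_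
    rw [norm_norm]
    refine (norm_sub_le _ _).trans (add_le_add ?_ (norm_cexp_neg_sq_div_two t).le)
    by_cases ht : |(√n)⁻¹ * t| ≤ δ
    · rw [Set.indicator_of_mem (by exact ht), norm_pow, one_mul]
      calc _ ≤ Real.exp (-((√n)⁻¹ * t) ^ 2 / 4) ^ n := by gcongr; exact hexp _ ht
        _ = _ := by
          rw [← Real.exp_nat_mul]
          congr 1
          rw [mul_pow, inv_pow, Real.sq_sqrt (by positivity)]
          field_simp
    · rw [Set.indicator_of_notMem (by exact ht), norm_zero]
      positivity
  · exact ((integrable_exp_neg_mul_sq (by norm_num)).const_mul 1).add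
      (integrable_exp_neg_mul_sq (by norm_num))
  · refine ae_of_all _ fun t => ?_
    have h0 : Tendsto (fun n : ℕ => |(√n)⁻¹ * t|) atTop (𝓝 0) := by
      have : Tendsto (fun n : ℕ => (√(n : ℝ))⁻¹) atTop (𝓝 0) :=
        tendsto_inv_atTop_zero.comp (Real.tendsto_sqrt_atTop.comp tendsto_natCast_atTop_atTop)
      simpa using (this.mul_const t).abs
    have h1 : ∀ᶠ n : ℕ in atTop, {t : ℝ | |(√n)⁻¹ * t| ≤ δ}.indicator
        (fun t => charFun μ ((√n)⁻¹ * t) ^ n) t = charFun μ ((√n)⁻¹ * t) ^ n := by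
      filter_upwards [h0.eventually (gt_mem_nhds hδ)] with n hn
      exact Set.indicator_of_mem (by exact hn.le) _
    have h2 := (((hlim t).congr' (h1.mono fun n hn => hn.symm)).sub_const
      (Complex.exp (-t ^ 2 / 2))).norm
    simpa using h2

lemma integrable_charFun_pow_comp_mul {m n : ℕ} (hm : Integrable fun t => ‖charFun μ t‖ ^ m)
    (hmn : m ≤ n) {c : ℝ} (hc : c ≠ 0) : Integrable fun t => charFun μ (c * t) ^ n := by
  have hmeas := measurable_charFun (μ := μ)
  have h : Integrable fun t => charFun μ t ^ n := by
    refine hm.mono' (hmeas.pow_const n).aestronglyMeasurable (ae_of_all _ fun t => ?_)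
    rw [norm_pow]
    exact pow_le_pow_of_le_one (norm_nonneg _) (norm_charFun_le_one t) hmn
  exact h.comp_mul_left' hc

lemma integrable_cexp_neg_sq_div_two : Integrable fun t : ℝ => Complex.exp (-(t : ℂ) ^ 2 / 2) := by
  rw [← integrable_norm_iff (by fun_prop)]
  simp_rw [norm_cexp_neg_sq_div_two]
  exact integrable_exp_neg_mul_sq (by norm_num)

/-- The characteristic functions of normalized sums converge to the Gaussian one in `L¹`,
provided that some power of the characteristic function of the summands is integrable. -/
theorem tendsto_integral_norm_charFun_pow_sub {m : ℕ} (hm0 : m ≠ 0)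
    (hm : Integrable fun t => ‖charFun μ t‖ ^ m)
    (htaylor : (fun t : ℝ => charFun μ t - (1 - (t : ℂ) ^ 2 / 2)) =o[𝓝 0] fun t => t ^ 2)
    (hlim : ∀ t : ℝ, Tendsto (fun n : ℕ => charFun μ ((√n)⁻¹ * t) ^ n) atTop
      (𝓝 (Complex.exp (-t ^ 2 / 2)))) :
    Tendsto (fun n : ℕ => ∫ t : ℝ, ‖charFun μ ((√n)⁻¹ * t) ^ n - Complex.exp (-t ^ 2 / 2)‖)
      atTop (𝓝 0) := by
  obtain ⟨δ, hδ, hexp⟩ := exists_norm_le_exp_neg_sq_div_four htaylor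
  obtain ⟨η, hη0, hη1, hη⟩ :=
    exists_norm_charFun_le_lt_one (tendsto_norm_charFun_cocompact hm0 hm) hδ
  have hsum := (tendsto_integral_norm_indicator_sub hδ hexp hlim).add
    (tendsto_integral_norm_indicator_compl hη0 hη1 hη hm)
  rw [add_zero] at hsum
  refine squeeze_zero' (Eventually.of_forall fun n => integral_nonneg fun _ => norm_nonneg _) ?_
    hsum
  filter_upwards [eventually_ge_atTop (m + 1)] with n hn
  have hset : MeasurableSet {t : ℝ | |(√n)⁻¹ * t| ≤ δ} :=
    measurableSet_le (by fun_prop) measurable_const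
  have hint := integrable_charFun_pow_comp_mul hm (by omega : m ≤ n)
    (show (√(n : ℝ))⁻¹ ≠ 0 by
      have : (0 : ℝ) < n := by exact_mod_cast (by omega : 0 < n)
      positivity)
  have h1 := ((hint.indicator hset).sub integrable_cexp_neg_sq_div_two).norm
  have h2 := (hint.indicator hset.compl).norm
  refine le_of_le_of_eq ?_ (integral_add h1 h2)
  refine integral_mono_of_nonneg (ae_of_all _ fun _ => norm_nonneg _) (h1.add h2)
    (ae_of_all _ fun t => ?_)
  simp only
  have h3 := Set.indicator_self_add_compl_apply {t : ℝ | |(√n)⁻¹ * t| ≤ δ}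
    (fun t => charFun μ ((√n)⁻¹ * t) ^ n) t
  refine (norm_add_le _ _).trans' (le_of_eq (congrArg _ ?_))
  linear_combination -h3

end CharFunConvergence

/-! ### From uniform convergence to `L^r` norms -/

section UniformConvergence

variable {r : ℝ≥0∞}

lemma one_lt_toReal_of_ne_top (hr : 1 < r) (hr' : r ≠ ∞) : 1 < r.toReal := by
  rw [← ENNReal.toReal_one]
  exact (ENNReal.toReal_lt_toReal ENNReal.one_ne_top hr').2 hr

/-- Interpolation between `L^∞` and `L¹`: `|d|^r ≤ ε^(r-1) |d|`. Since `r > 1`, the bound vanishes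
with `ε`. -/
lemma eLpNorm_le_of_abs_le_of_lintegral_le (hr : 1 < r) (hr' : r ≠ ∞) {d : ℝ → ℝ} {ε : ℝ}
    {M : ℝ≥0∞} (hd : ∀ x, |d x| ≤ ε) (hM : ∫⁻ x, ‖d x‖ₑ ≤ M) :
    eLpNorm d r volume ≤ (ENNReal.ofReal ε ^ (r.toReal - 1) * M) ^ (1 / r.toReal) := by
  have hr1 := one_lt_toReal_of_ne_top hr hr'
  have hd' : ∀ x, ‖d x‖ₑ ≤ ENNReal.ofReal ε := fun x => by
    rw [← ofReal_norm]
    exact ENNReal.ofReal_le_ofReal (hd x)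
  rw [eLpNorm_eq_lintegral_rpow_enorm_toReal (by positivity) hr']
  gcongr
  calc ∫⁻ x, ‖d x‖ₑ ^ r.toReal
      ≤ ∫⁻ x, ENNReal.ofReal ε ^ (r.toReal - 1) * ‖d x‖ₑ := by
        refine lintegral_mono fun x => ?_
        calc ‖d x‖ₑ ^ r.toReal = ‖d x‖ₑ ^ (r.toReal - 1) * ‖d x‖ₑ ^ (1 : ℝ) := by
              rw [← ENNReal.rpow_add_of_nonneg _ _ (by linarith) zero_le_one, sub_add_cancel]
          _ ≤ _ := by
              rw [ENNReal.rpow_one]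
              gcongr
              exact hd' x
    _ ≤ _ := by
        rw [lintegral_const_mul' _ _ (ENNReal.rpow_ne_top_of_nonneg (by linarith)
          ENNReal.ofReal_ne_top)]
        gcongr

lemma eLpNorm_ne_top_of_abs_le (hr : 1 < r) {g : ℝ → ℝ} {C : ℝ} (hg : ∀ x, |g x| ≤ C)
    (hint : Integrable g) : eLpNorm g r volume ≠ ∞ := by
  rcases eq_or_ne r ∞ with rfl | hr'
  · rw [eLpNorm_exponent_top]
    exact (eLpNormEssSup_lt_top_of_ae_bound (ae_of_all _ hg)).ne
  · have hr1 := one_lt_toReal_of_ne_top hr hr'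
    refine ne_top_of_le_ne_top ?_ (eLpNorm_le_of_abs_le_of_lintegral_le hr hr' hg le_rfl)
    refine ENNReal.rpow_ne_top_of_nonneg (by positivity) (ENNReal.mul_ne_top
      (ENNReal.rpow_ne_top_of_nonneg (by linarith) ENNReal.ofReal_ne_top) hint.2.ne)

/-- Uniform convergence together with boundedness in `L¹` implies convergence of `L^r` norms. -/
lemma tendsto_eLpNorm_of_uniform (hr : 1 < r) {g : ℕ → ℝ → ℝ} {h : ℝ → ℝ} {ε : ℕ → ℝ}
    {M : ℝ≥0∞} (hM : M ≠ ∞) (hε : Tendsto ε atTop (𝓝 0))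
    (hg : ∀ᶠ n in atTop, AEStronglyMeasurable (g n) volume) (hh : AEStronglyMeasurable h volume)
    (hbd : ∀ᶠ n in atTop, ∀ x, |g n x - h x| ≤ ε n)
    (hint : ∀ᶠ n in atTop, ∫⁻ x, ‖g n x - h x‖ₑ ≤ M) (hfin : eLpNorm h r volume ≠ ∞) :
    Tendsto (fun n => eLpNorm (g n) r volume) atTop (𝓝 (eLpNorm h r volume)) := by
  have hlim : Tendsto (fun n => eLpNorm (g n - h) r volume) atTop (𝓝 0) := by
    have hε' : Tendsto (fun n => ENNReal.ofReal (ε n)) atTop (𝓝 0) := by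
      simpa using ENNReal.tendsto_ofReal hε
    rcases eq_or_ne r ∞ with rfl | hr'
    · refine tendsto_of_tendsto_of_tendsto_of_le_of_le' tendsto_const_nhds hε'
        (Eventually.of_forall fun _ => zero_le) ?_
      filter_upwards [hbd] with n hn
      rw [eLpNorm_exponent_top]
      exact eLpNormEssSup_le_of_ae_bound (ae_of_all _ hn)
    · have hr1 := one_lt_toReal_of_ne_top hr hr'
      have h1 := (ENNReal.continuous_rpow_const (y := r.toReal - 1)).tendsto 0 |>.comp hε'
      rw [ENNReal.zero_rpow_of_pos (by linarith)] at h1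
      have h2 := ENNReal.Tendsto.mul_const h1 (Or.inr hM)
      rw [zero_mul] at h2
      have h3 := (ENNReal.continuous_rpow_const (y := 1 / r.toReal)).tendsto 0 |>.comp h2
      rw [ENNReal.zero_rpow_of_pos (by positivity)] at h3
      refine tendsto_of_tendsto_of_tendsto_of_le_of_le' tendsto_const_nhds h3
        (Eventually.of_forall fun _ => zero_le) ?_
      filter_upwards [hbd, hint] with n hn hn'
      exact eLpNorm_le_of_abs_le_of_lintegral_le hr hr' hn hn'
  have hup : Tendsto (fun n => eLpNorm h r volume + eLpNorm (g n - h) r volume) atTop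
      (𝓝 (eLpNorm h r volume)) := by
    simpa using hlim.const_add (eLpNorm h r volume)
  -- Subtraction in `ℝ≥0∞` is continuous here because the norm of `h` is finite.
  have hlow : Tendsto (fun n => eLpNorm h r volume - eLpNorm (g n - h) r volume) atTop
      (𝓝 (eLpNorm h r volume)) := by
    simpa using ENNReal.Tendsto.sub tendsto_const_nhds hlim (Or.inl hfin)
  refine tendsto_of_tendsto_of_tendsto_of_le_of_le' hlow hup ?_ ?_
  · filter_upwards [hg] with n hn
    rw [tsub_le_iff_right, eLpNorm_sub_comm]
    calc eLpNorm h r volume = eLpNorm (g n + (h - g n)) r volume := by simp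
      _ ≤ _ := eLpNorm_add_le hn (hh.sub hn) hr.le
  · filter_upwards [hg] with n hn
    calc eLpNorm (g n) r volume = eLpNorm (h + (g n - h)) r volume := by simp
      _ ≤ _ := eLpNorm_add_le hh (hn.sub hh) hr.le

lemma lintegral_enorm_inversionDensity {μ : Measure ℝ} [IsProbabilityMeasure μ]
    (hμ : Integrable (charFun μ)) : ∫⁻ x, ‖inversionDensity (charFun μ) x‖ₑ = 1 := by
  have h := congrArg (fun κ : Measure ℝ => κ Set.univ) (eq_withDensity_inversionDensity hμ)
  simp only [measure_univ, withDensity_apply _ MeasurableSet.univ, Measure.restrict_univ] at h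
  rw [h]
  exact lintegral_congr fun x => Real.enorm_of_nonneg (inversionDensity_charFun_nonneg hμ x)

/-- If characteristic functions converge in `L¹`, then the `L^r` norms of the densities converge,
for every `1 < r ≤ ∞`. -/
theorem tendsto_eLpNorm_inversionDensity (hr : 1 < r) {κ : ℕ → Measure ℝ} {μ : Measure ℝ}
    [∀ n, IsProbabilityMeasure (κ n)] [IsProbabilityMeasure μ] (hμ : Integrable (charFun μ))
    (hκ : ∀ᶠ n in atTop, Integrable (charFun (κ n)))
    (hlim : Tendsto (fun n => ∫ t, ‖charFun (κ n) t - charFun μ t‖) atTop (𝓝 0)) :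
    Tendsto (fun n => eLpNorm (inversionDensity (charFun (κ n))) r volume) atTop
      (𝓝 (eLpNorm (inversionDensity (charFun μ)) r volume)) := by
  refine tendsto_eLpNorm_of_uniform hr (M := 1 + 1) (by finiteness) hlim
    (hκ.mono fun n hn => (continuous_inversionDensity hn).aestronglyMeasurable)
    (continuous_inversionDensity hμ).aestronglyMeasurable
    (hκ.mono fun n hn => abs_inversionDensity_sub_le hn hμ) (hκ.mono fun n hn => ?_)
    (eLpNorm_ne_top_of_abs_le hr (abs_inversionDensity_le _)
      (integrable_inversionDensity_charFun hμ))
  calc _ ≤ ∫⁻ x, (‖inversionDensity (charFun (κ n)) x‖ₑ + ‖inversionDensity (charFun μ) x‖ₑ) :=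
        lintegral_mono fun x => enorm_sub_le
    _ = 1 + 1 := by
        rw [lintegral_add_left (continuous_inversionDensity hn).measurable.enorm,
          lintegral_enorm_inversionDensity hn, lintegral_enorm_inversionDensity hμ]

end UniformConvergence

/-! ### Rényi entropies as functions of the density -/

section Renyi

variable {Ω : Type*} [MeasurableSpace Ω] {P : Measure Ω} {Y : Ω → ℝ} {r : ℝ≥0∞}

/-- Holds in the degenerate cases too, as `log 0 = ⊥`. Since `x ↦ log √x` is a homeomorphism of `[0,
∞]` onto `[-∞, ∞]`, the two kinds of convergence agree. -/
lemma renyiEntropy_eq_log (Y : Ω → ℝ) (P : Measure Ω) (r : ℝ≥0∞) :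
    renyiEntropy r Y P = ENNReal.log (renyiEntropyPower r Y P ^ (1 / 2 : ℝ)) := by
  unfold renyiEntropy renyiEntropyPower
  split_ifs with h1 h2
  · rw [← ENNReal.rpow_mul, ENNReal.log_rpow]
    norm_num
  · rw [← ENNReal.rpow_mul, ENNReal.log_rpow]
    congr 2
    ring
  · simp

lemma tendsto_renyiEntropy_iff {Ω' : Type*} [MeasurableSpace Ω'] {P' : Measure Ω'}
    {Y : ℕ → Ω → ℝ} {Z : Ω' → ℝ} :
    Tendsto (fun n => renyiEntropyPower r (Y n) P) atTop (𝓝 (renyiEntropyPower r Z P')) ↔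
      Tendsto (fun n => renyiEntropy r (Y n) P) atTop (𝓝 (renyiEntropy r Z P')) := by
  simp only [renyiEntropy_eq_log]
  constructor
  · intro h
    exact ((ENNReal.continuous_log.comp ENNReal.continuous_rpow_const).tendsto _).comp h
  · intro h
    have h1 := (ENNReal.logHomeomorph.symm.continuous.tendsto _).comp h
    have h2 := ((ENNReal.continuous_rpow_const (y := 2)).tendsto _).comp h1
    have e : ∀ x : ℝ≥0∞,
        (ENNReal.logHomeomorph.symm (ENNReal.log (x ^ (1 / 2 : ℝ)))) ^ (2 : ℝ) = x := by
      intro x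
      have : ENNReal.logHomeomorph.symm (ENNReal.log (x ^ (1 / 2 : ℝ))) = x ^ (1 / 2 : ℝ) :=
        ENNReal.logHomeomorph.symm_apply_apply _
      rw [this, ← ENNReal.rpow_mul]
      norm_num
    simpa only [Function.comp_def, e] using h2

variable [IsProbabilityMeasure P]

lemma hasPDF_of_integrable_charFun (hY : AEMeasurable Y P)
    (hφ : Integrable (charFun (P.map Y))) :
    HasPDF Y P volume ∧ pdf Y P volume =ᵐ[volume]
      fun x => ENNReal.ofReal (inversionDensity (charFun (P.map Y)) x) := by
  have := Measure.isProbabilityMeasure_map hY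
  have hmeas : AEMeasurable
      (fun x => ENNReal.ofReal (inversionDensity (charFun (P.map Y)) x)) volume :=
    (continuous_inversionDensity hφ).measurable.ennreal_ofReal.aemeasurable
  have h := eq_withDensity_inversionDensity hφ
  have hpdf : HasPDF Y P volume := hasPDF_of_map_eq_withDensity hY _ hmeas h
  exact ⟨hpdf, (pdf.eq_of_map_eq_withDensity _ hmeas).1 h⟩

lemma hasBoundedDensity_of_integrable_charFun (hY : AEMeasurable Y P)
    (hφ : Integrable (charFun (P.map Y))) : HasBoundedDensity Y P := by
  obtain ⟨h1, h2⟩ := hasPDF_of_integrable_charFun hY hφ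
  refine ⟨h1, (∫ t, ‖charFun (P.map Y) t‖).toNNReal, h2.mono fun x hx => ?_⟩
  rw [hx]
  exact ENNReal.ofReal_le_ofReal ((le_abs_self _).trans (abs_inversionDensity_le _ x))

/-- Covers finite and infinite `r` at once, so that convergence of `L^r` norms is all that is
needed. -/
lemma renyiEntropyPower_eq_eLpNorm (hr : 1 < r) (hY : AEMeasurable Y P)
    (hφ : Integrable (charFun (P.map Y))) :
    renyiEntropyPower r Y P = eLpNorm (inversionDensity (charFun (P.map Y))) r volume ^
      (if r = ∞ then -2 else r.toReal * -(2 / (r.toReal - 1)) : ℝ) := by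
  have := Measure.isProbabilityMeasure_map hY
  obtain ⟨h1, h2⟩ := hasPDF_of_integrable_charFun hY hφ
  have h3 : pdf Y P volume =ᵐ[volume] fun x => ‖inversionDensity (charFun (P.map Y)) x‖ₑ :=
    h2.trans (ae_of_all _ fun x =>
      (Real.enorm_of_nonneg (inversionDensity_charFun_nonneg hφ x)).symm)
  rw [renyiEntropyPower, if_pos h1]
  split_ifs with hr'
  · rw [hr', eLpNorm_exponent_top, essSup_congr_ae h3]
    rfl
  · have hr1 := one_lt_toReal_of_ne_top hr hr'
    rw [eLpNorm_eq_lintegral_rpow_enorm_toReal (by positivity) hr', ← ENNReal.rpow_mul,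
      ← mul_assoc, one_div_mul_cancel (by positivity), one_mul]
    congr 1
    exact lintegral_congr_ae (h3.mono fun x hx => by simp only [hx])

lemma exists_integrable_norm_charFun_pow_of_hasPDF [HasPDF Y P volume] {s : ℝ} (hs : 1 < s)
    (h : ∫⁻ x, pdf Y P volume x ^ s ≠ ∞) :
    ∃ k : ℕ, 1 ≤ k ∧ Integrable fun t => ‖charFun (P.map Y) t‖ ^ k := by
  have := Measure.isProbabilityMeasure_map (HasPDF.aemeasurable Y P volume)
  exact exists_integrable_norm_charFun_pow (measurable_pdf Y P volume)
    (map_eq_withDensity_pdf Y P volume) hs h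

lemma HasBoundedDensity.exists_integrable_norm_charFun_pow (h : HasBoundedDensity Y P) :
    ∃ k : ℕ, 1 ≤ k ∧ Integrable fun t => ‖charFun (P.map Y) t‖ ^ k := by
  obtain ⟨h1, M, hM⟩ := h
  -- A density bounded by `M` satisfies `p² ≤ M p`, and `p` has mass 1.
  refine exists_integrable_norm_charFun_pow_of_hasPDF (s := 2) one_lt_two ?_
  refine ne_top_of_le_ne_top (b := M * 1) (by finiteness) ?_
  calc _ ≤ ∫⁻ x, M * pdf Y P volume x := by
        refine lintegral_mono_ae (hM.mono fun x hx => ?_)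
        rw [ENNReal.rpow_two, sq]
        gcongr
    _ = M * 1 := by
        rw [lintegral_const_mul _ (measurable_pdf Y P volume), pdf.lintegral_eq_measure_univ,
          measure_univ]

/-- The value 0 is taken when there is no density or the integral (essential supremum) is infinite;
excluding it leaves a density in `L^r`. -/
lemma exists_integrable_norm_charFun_pow_of_renyiEntropyPower_ne_zero (hr : 1 < r)
    (h : renyiEntropyPower r Y P ≠ 0) :
    ∃ k : ℕ, 1 ≤ k ∧ Integrable fun t => ‖charFun (P.map Y) t‖ ^ k := by
  rw [renyiEntropyPower] at h
  split_ifs at h with h1 hr'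
  · refine HasBoundedDensity.exists_integrable_norm_charFun_pow
      ⟨h1, (essSup (pdf Y P volume) volume).toNNReal, ?_⟩
    have hfin : essSup (pdf Y P volume) volume ≠ ∞ := by
      intro h2
      simp [h2] at h
    rw [ENNReal.coe_toNNReal hfin]
    exact ENNReal.ae_le_essSup _
  · have hr1 := one_lt_toReal_of_ne_top hr hr'
    refine exists_integrable_norm_charFun_pow_of_hasPDF hr1 fun h2 => h ?_
    rw [h2, ENNReal.top_rpow_of_neg]
    have : 0 < r.toReal - 1 := by linarith
    exact neg_neg_of_pos (by positivity)
  · exact absurd rfl h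

end Renyi

/-! ### Passing between `Z_n` and the summands -/

section NormalizedSum

variable {Ω : Type*} [MeasurableSpace Ω] {P : Measure Ω} {X : ℕ → Ω → ℝ}

lemma aemeasurable_normalizedSum (hident : ∀ k, IdentDistrib (X k) (X 0) P P) (n : ℕ) :
    AEMeasurable (normalizedSum X n) P :=
  (Finset.aemeasurable_fun_sum _ fun k _ => (hident k).aemeasurable_fst).div_const _

lemma charFun_map_normalizedSum (hindep : iIndepFun X P)
    (hident : ∀ k, IdentDistrib (X k) (X 0) P P) (n : ℕ) (t : ℝ) :
    charFun (P.map (normalizedSum X n)) t = charFun (P.map (X 0)) ((√n)⁻¹ * t) ^ n := by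
  rw [← charFun_inv_sqrt_mul_sum hindep hident,
    show normalizedSum X n = fun ω => (√n)⁻¹ * ∑ k ∈ Finset.range n, X k ω from
      funext fun ω => div_eq_inv_mul _ _]

/-- The `k`-th power for `Z_n` is `|f(t/√n)|^(nk)`; undoing the scaling gives `ν = nk`. -/
lemma exists_integrable_norm_charFun_rpow (hindep : iIndepFun X P)
    (hident : ∀ k, IdentDistrib (X k) (X 0) P P) {n : ℕ} (hn : 1 ≤ n)
    (h : ∃ k : ℕ, 1 ≤ k ∧ Integrable fun t => ‖charFun (P.map (normalizedSum X n)) t‖ ^ k) :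
    ∃ ν : ℝ, 1 ≤ ν ∧ Integrable (fun t : ℝ => ‖charFun (P.map (X 0)) t‖ ^ ν) volume := by
  obtain ⟨k, hk, h⟩ := h
  have hs : (√(n : ℝ))⁻¹ ≠ 0 := by
    have : (0 : ℝ) < n := by exact_mod_cast hn
    positivity
  refine ⟨(n * k : ℕ), by exact_mod_cast Nat.mul_pos hn hk, ?_⟩
  simp only [Real.rpow_natCast]
  refine (integrable_comp_mul_left_iff (fun t => ‖charFun (P.map (X 0)) t‖ ^ (n * k)) hs).1 ?_
  refine h.congr (ae_of_all _ fun t => ?_)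
  simp only [charFun_map_normalizedSum hindep hident, norm_pow, pow_mul]

lemma exists_integrable_norm_charFun_natPow {μ : Measure ℝ} [IsProbabilityMeasure μ]
    (h : ∃ ν : ℝ, 1 ≤ ν ∧ Integrable (fun t : ℝ => ‖charFun μ t‖ ^ ν) volume) :
    ∃ m : ℕ, m ≠ 0 ∧ Integrable fun t : ℝ => ‖charFun μ t‖ ^ m := by
  obtain ⟨ν, hν, h⟩ := h
  obtain ⟨m, hm⟩ := exists_nat_ge ν
  have hm1 : (1 : ℝ) ≤ m := hν.trans hm
  refine ⟨m, by rintro rfl; norm_num at hm1, h.mono' ?_ (ae_of_all _ fun t => ?_)⟩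
  · exact (measurable_charFun.norm.pow_const m).aestronglyMeasurable
  · rw [Real.norm_of_nonneg (by positivity), ← Real.rpow_natCast]
    exact Real.rpow_le_rpow_of_exponent_ge' (norm_nonneg _) (norm_charFun_le_one t)
      (by linarith) hm

lemma eventually_integrable_charFun_normalizedSum [IsProbabilityMeasure P]
    (hindep : iIndepFun X P) (hident : ∀ k, IdentDistrib (X k) (X 0) P P) {m : ℕ}
    (hm : Integrable fun t => ‖charFun (P.map (X 0)) t‖ ^ m) :
    ∀ᶠ n : ℕ in atTop, Integrable (charFun (P.map (normalizedSum X n))) := by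
  have := Measure.isProbabilityMeasure_map (hident 0).aemeasurable_fst
  filter_upwards [eventually_ge_atTop (m + 1)] with n hn
  rw [funext (charFun_map_normalizedSum hindep hident n)]
  refine integrable_charFun_pow_comp_mul hm (by omega) ?_
  have : (0 : ℝ) < n := by exact_mod_cast (by omega : 0 < n)
  positivity

end NormalizedSum

/-! ### The Gaussian limit -/

section Gaussian

variable {Ω : Type*} [MeasurableSpace Ω] {P : Measure Ω} {Z : Ω → ℝ}

lemma charFun_standardGaussian (t : ℝ) :
    charFun (gaussianReal 0 1) t = Complex.exp (-(t : ℂ) ^ 2 / 2) := by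
  rw [charFun_gaussianReal]
  congr 1
  push_cast
  ring

lemma integrable_charFun_standardGaussian : Integrable (charFun (gaussianReal 0 1)) := by
  rw [funext charFun_standardGaussian]
  exact integrable_cexp_neg_sq_div_two

/-- The `L^r` norm of the density is finite, and positive because the mass is 1. Hence convergence
forces `N_r(Z_n) ≠ 0` for large `n`. -/
lemma renyiEntropyPower_standardGaussian_ne_zero [IsProbabilityMeasure P] {r : ℝ≥0∞} (hr : 1 < r)
    (hZ : HasLaw Z (gaussianReal 0 1) P) : renyiEntropyPower r Z P ≠ 0 := by
  have hint := integrable_charFun_standardGaussian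
  rw [renyiEntropyPower_eq_eLpNorm hr hZ.aemeasurable (by rwa [hZ.map_eq]), hZ.map_eq]
  have hfin := eLpNorm_ne_top_of_abs_le hr (abs_inversionDensity_le _)
    (integrable_inversionDensity_charFun hint)
  have hpos : eLpNorm (inversionDensity (charFun (gaussianReal 0 1))) r volume ≠ 0 := by
    rw [Ne, eLpNorm_eq_zero_iff (continuous_inversionDensity hint).aestronglyMeasurable
      (by positivity)]
    intro h
    have h1 := lintegral_enorm_inversionDensity hint
    rw [lintegral_congr_ae (h.mono fun x hx => by simp only [hx]; rfl)] at h1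
    simp at h1
  exact (ENNReal.rpow_pos (pos_iff_ne_zero.2 hpos) hfin).ne'

end Gaussian

/-! ### The equivalence -/

theorem theorem1p1 {Ω Ω' : Type*} [MeasurableSpace Ω] [MeasurableSpace Ω']
    (P : Measure Ω) [IsProbabilityMeasure P] (P' : Measure Ω') [IsProbabilityMeasure P']
    (X : ℕ → Ω → ℝ) (hindep : iIndepFun X P)
    (hident : ∀ k, IdentDistrib (X k) (X 0) P P)
    (hmean : ∫ ω, X 0 ω ∂P = 0) (hvar : Var[X 0; P] = 1)
    (Z : Ω' → ℝ) (hZ : HasLaw Z (gaussianReal 0 1) P')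
    (r : ℝ≥0∞) (hr : 1 < r) :
    List.TFAE [
      Tendsto (fun n => renyiEntropyPower r (normalizedSum X n) P) atTop
        (𝓝 (renyiEntropyPower r Z P')),
      Tendsto (fun n => renyiEntropy r (normalizedSum X n) P) atTop
        (𝓝 (renyiEntropy r Z P')),
      ∃ ν : ℝ, 1 ≤ ν ∧ Integrable (fun t : ℝ => ‖charFun (P.map (X 0)) t‖ ^ ν) volume,
      ∀ᶠ n : ℕ in atTop, HasBoundedDensity (normalizedSum X n) P,
      ∃ n : ℕ, 1 ≤ n ∧ HasBoundedDensity (normalizedSum X n) P] := by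
  have hX0 := (hident 0).aemeasurable_fst
  have := Measure.isProbabilityMeasure_map hX0
  have hae := aemeasurable_normalizedSum hident
  tfae_have 1 ↔ 2 := tendsto_renyiEntropy_iff
  tfae_have 1 → 3 := by
    intro h
    obtain ⟨n, hn, hn1⟩ := ((h.eventually_ne (renyiEntropyPower_standardGaussian_ne_zero hr hZ)).and
      (eventually_ge_atTop 1)).exists
    exact exists_integrable_norm_charFun_rpow hindep hident hn1
      (exists_integrable_norm_charFun_pow_of_renyiEntropyPower_ne_zero hr hn)
  tfae_have 3 → 1 := by
    intro h
    obtain ⟨m, hm0, hm⟩ := exists_integrable_norm_charFun_natPow h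
    have hsq : ∫ ω, (X 0 ^ 2) ω ∂P = 1 := by
      rw [← hvar, variance_eq_integral hX0, hmean]
      simp
    have hlim := tendsto_integral_norm_charFun_pow_sub hm0 hm
      (taylor_charFun_two hX0 hmean hsq) (tendsto_charFun_inv_sqrt_mul_pow hX0 hmean hsq)
    simp only [← charFun_standardGaussian, ← charFun_map_normalizedSum hindep hident] at hlim
    have (n : ℕ) := Measure.isProbabilityMeasure_map (hae n)
    have hev := eventually_integrable_charFun_normalizedSum hindep hident hm
    have hnorm := tendsto_eLpNorm_inversionDensity hr integrable_charFun_standardGaussian hev hlim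
    rw [renyiEntropyPower_eq_eLpNorm hr hZ.aemeasurable
      (by rw [hZ.map_eq]; exact integrable_charFun_standardGaussian), hZ.map_eq]
    -- The norm formula is available only for large `n`, once the characteristic function of `Z_n`
    -- is integrable.
    refine ((ENNReal.continuous_rpow_const.tendsto _).comp hnorm).congr' ?_
    filter_upwards [hev] with n hn
    exact (renyiEntropyPower_eq_eLpNorm hr (hae n) hn).symm
  tfae_have 3 → 4 := by
    intro h
    obtain ⟨m, -, hm⟩ := exists_integrable_norm_charFun_natPow h
    exact (eventually_integrable_charFun_normalizedSum hindep hident hm).mono fun n hn =>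
      hasBoundedDensity_of_integrable_charFun (hae n) hn
  tfae_have 4 → 5 := fun h =>
    let ⟨n, h1, h2⟩ := (h.and (eventually_ge_atTop 1)).exists
    ⟨n, h2, h1⟩
  tfae_have 5 → 3 := fun ⟨n, hn, h⟩ =>
    exists_integrable_norm_charFun_rpow hindep hident hn h.exists_integrable_norm_charFun_pow
  tfae_finish
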